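/- Let $A$ be a uniform algebra, that is, a commutative Banach algebra isometrically isomorphic to a closed subalgebra of $C(K)$, for some compact Hausdorff space $K$, that contains the constants and separates the points of $K$. Let $\Delta(A)$ be its Gelfand space, the set of non-zero multiplicative linear functionals on $A$ with the weak$^{*}$ topology. Assume that $\Delta(A)$ is scattered, i.e. every non-empty subset of $\Delta(A)$ has a relatively isolated point, and that $A\in NP_\infty$, i.e. for every $n$, all pairwise distinct $\varphi_1,\dots,\varphi_n\in\Delta(A)$ and all $(a_1,\dots,a_n)\in\mathbb{C}^n$, $$\inf\{\|x\|_A : x\in A,\ \varphi_i(x)=a_i \text{ for } i=1,\dots,n\}=\max_{1\le i\le n}|a_i|.$$ Then $A=C(\Delta(A))$, i.e. the Gelfand transform $x\mapsto\widehat{x}$, $\widehat{x}(\varphi)=\varphi(x)$, is an isometric isomorphism of $A$ onto $C(\Delta(A))$. -/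

import Mathlib

open WeakDual

/-- A topological space is scattered if every nonempty subset has a point that is isolated in the
relative topology of that subset. -/
def IsScattered (X : Type*) [TopologicalSpace X] : Prop :=
  ∀ S : Set X, S.Nonempty → ∃ x ∈ S, ∃ U : Set X, IsOpen U ∧ U ∩ S = {x}

/-- A uniform algebra on the space `K`: a closed subalgebra of `C(K)` that contains the constants
(this is built into `Subalgebra`) and separates the points of `K`. -/
structure IsUniformSubalgebra {K : Type*} [TopologicalSpace K] [CompactSpace K]
    (B : Subalgebra ℂ C(K, ℂ)) : Prop where
  isClosed : IsClosed (B : Set C(K, ℂ))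
  separatesPoints : B.SeparatesPoints

/-- A normed algebra is a uniform algebra if it is isometrically isomorphic to a uniform algebra on
some compact Hausdorff space. A uniform algebra `B` on `K` is itself an instance, through the
identity. -/
def IsUniformAlgebra.{u} (A : Type u) [NormedCommRing A] [NormedAlgebra ℂ A] : Prop :=
  ∃ (K : Type u) (_ : TopologicalSpace K) (_ : CompactSpace K) (_ : T2Space K)
    (B : Subalgebra ℂ C(K, ℂ)) (e : A ≃ₐ[ℂ] B), IsUniformSubalgebra B ∧ Isometry e

/-- The Nevanlinna-Pick norm of `a ∈ ℂⁿ` with respect to the characters `φ₁, …, φₙ` of `A`. For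
pairwise distinct characters the set of interpolating elements is nonempty. -/
noncomputable def npNorm (A : Type*) [NormedCommRing A] [NormedAlgebra ℂ A] {n : ℕ}
    (φ : Fin n → characterSpace ℂ A) (a : Fin n → ℂ) : ℝ :=
  sInf {r : ℝ | ∃ x : A, (∀ i, φ i x = a i) ∧ r = ‖x‖}

/-- Membership in the class `NP_∞`: all Nevanlinna-Pick norms are supremum norms (the norm of
`Fin n → ℂ` is the supremum norm). The class is considered among semisimple algebras, and every
uniform algebra is semisimple. -/
def MemNPInfty (A : Type*) [NormedCommRing A] [NormedAlgebra ℂ A] : Prop :=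
  ∀ (n : ℕ) (φ : Fin n → characterSpace ℂ A), Function.Injective φ →
    ∀ a : Fin n → ℂ, npNorm A φ a = ‖a‖

open Filter Topology Set

/-! The Gelfand image is closed, separates points, and is inverse-closed, since an element killed by
no character is a unit. By Stone–Weierstrass it suffices that its self-adjoint part separates
points. Given `f x ≠ f y`, scatteredness yields a circle about `f x`, with `f y` outside, that
misses the range of `f`. Rescaled to the unit circle, `f` becomes `w`, and the inverses of `1 + w ^
N` converge to the real indicator of `{|w| < 1}`. -/

/-- The range of a continuous real function on a compact scattered space contains no interval. -/
theorem IsScattered.exists_mem_Ioo_notMem_range {X : Type*} [TopologicalSpace X] [CompactSpace X]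
    (hX : IsScattered X) {g : X → ℝ} (hg : Continuous g) {a b : ℝ} (hab : a < b) :
    ∃ c ∈ Ioo a b, c ∉ range g := by
  by_contra! hcover
  -- Take a minimal closed set whose image covers the interval; deleting an isolated point of it
  -- will contradict minimality.
  obtain ⟨Y, ⟨hYc, hYI⟩, hYmin⟩ :=
    zorn_superset {Y : Set X | IsClosed Y ∧ Ioo a b ⊆ g '' Y} (by
      intro C hC hchain
      rcases C.eq_empty_or_nonempty with rfl | hne
      · exact ⟨univ, ⟨isClosed_univ, fun t ht => by simpa using hcover t ht⟩, by simp⟩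
      refine ⟨⋂₀ C, ⟨isClosed_sInter fun Y hY => (hC hY).1, fun t ht => ?_⟩,
        fun Y hY => sInter_subset_of_mem hY⟩
      have : Nonempty C := hne.to_subtype
      obtain ⟨x, hx⟩ := IsCompact.nonempty_iInter_of_directed_nonempty_isCompact_isClosed
        (fun Y : C => (Y : Set X) ∩ g ⁻¹' {t})
        (fun Y Z => by
          rcases hchain.total Y.2 Z.2 with h | h
          · exact ⟨Y, subset_rfl, inter_subset_inter_left _ h⟩
          · exact ⟨Z, inter_subset_inter_left _ h, subset_rfl⟩)
        (fun Y => by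
          obtain ⟨y, hy, hyt⟩ := (hC Y.2).2 ht
          exact ⟨y, hy, hyt⟩)
        (fun Y => ((hC Y.2).1.inter (isClosed_singleton.preimage hg)).isCompact)
        (fun Y => (hC Y.2).1.inter (isClosed_singleton.preimage hg))
      rw [mem_iInter] at hx
      exact ⟨x, mem_sInter.2 fun Y hY => (hx ⟨Y, hY⟩).1, (hx ⟨_, hne.some_mem⟩).2⟩)
  obtain ⟨t, ht⟩ := nonempty_Ioo.2 hab
  obtain ⟨y, hy, U, hU, hUY⟩ := hX Y (by obtain ⟨y, hy, -⟩ := hYI ht; exact ⟨y, hy⟩)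
  have hclosed : IsClosed (Y \ U) := hYc.sdiff hU
  have hsub : Ioo a b ∩ {g y}ᶜ ⊆ g '' (Y \ U) := by
    rintro s ⟨hs, hsy⟩
    obtain ⟨z, hz, rfl⟩ := hYI hs
    refine ⟨z, ⟨hz, fun hzU => hsy ?_⟩, rfl⟩
    have hzy : z ∈ U ∩ Y := ⟨hzU, hz⟩
    rw [hUY] at hzy
    rw [mem_singleton_iff.1 hzy]
    rfl
  -- The image is compact and omits at most one point of the interval, hence omits none.
  have hIoo : Ioo a b ⊆ g '' (Y \ U) :=
    ((dense_compl_singleton (g y)).open_subset_closure_inter isOpen_Ioo).trans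
      (closure_minimal hsub (hclosed.isCompact.image hg).isClosed)
  have hyU : y ∈ U ∩ Y := by rw [hUY]; rfl
  exact (hYmin ⟨hclosed, hIoo⟩ sdiff_subset hy).2 hyU.1

theorem Complex.norm_inv_one_add_sub_one_le {z : ℂ} {t : ℝ} (ht : t < 1) (hz : ‖z‖ ≤ t) :
    ‖(1 + z)⁻¹ - 1‖ ≤ t / (1 - t) := by
  have hlow : 1 - t ≤ ‖1 + z‖ := by
    have := norm_sub_le_norm_add (1 : ℂ) z
    rw [norm_one] at this
    linarith
  have hne : 1 + z ≠ 0 := norm_pos_iff.1 (by linarith)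
  have heq : (1 + z)⁻¹ - 1 = -z / (1 + z) := by field_simp; ring
  rw [heq, norm_div, norm_neg]
  have := norm_nonneg z
  gcongr
  linarith

theorem Complex.norm_inv_one_add_le {z : ℂ} {t : ℝ} (ht0 : 0 < t) (ht : t < 1)
    (hz : 1 ≤ t * ‖z‖) : ‖(1 + z)⁻¹‖ ≤ t / (1 - t) := by
  have hlow : ‖z‖ - 1 ≤ ‖1 + z‖ := by
    have := norm_sub_le_norm_add z (1 : ℂ)
    rwa [norm_one, add_comm z] at this
  have hlow' : 1 - t ≤ t * ‖1 + z‖ := by nlinarith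
  have hpos : 0 < ‖1 + z‖ := by
    by_contra! h
    nlinarith
  rw [norm_inv, inv_eq_one_div, div_le_div_iff₀ hpos (by linarith)]
  linarith

/-- If `|w|` omits the value `1`, then `(1 + wᴺ)⁻¹` converges uniformly to the indicator function
of `{|w| < 1}`. -/
theorem ContinuousMap.exists_tendsto_inv_one_add_pow {X : Type*} [TopologicalSpace X]
    [CompactSpace X] (w : C(X, ℂ)) (hw : ∀ x, ‖w x‖ ≠ 1) (h : ℕ → C(X, ℂ))
    (hh : ∀ n x, h n x = (1 + w x ^ (n + 1))⁻¹) :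
    ∃ χ : C(X, ℂ), (∀ x, ‖w x‖ < 1 → χ x = 1) ∧ (∀ x, 1 < ‖w x‖ → χ x = 0) ∧
      Tendsto h atTop (𝓝 χ) := by
  classical
  have hclopen : IsClopen {x | ‖w x‖ < 1} := by
    refine ⟨?_, isOpen_lt (by fun_prop) (by fun_prop)⟩
    have : {x | ‖w x‖ < 1} = {x | ‖w x‖ ≤ 1} := by
      ext x
      exact (Ne.le_iff_lt (hw x)).symm
    rw [this]
    exact isClosed_le (by fun_prop) (by fun_prop)
  set χ : C(X, ℂ) := ⟨_, (LocallyConstant.charFn ℂ hclopen).continuous⟩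
  have hχ1 : ∀ x, ‖w x‖ < 1 → χ x = 1 := fun x hx => by
    simp [χ, LocallyConstant.coe_charFn, hx]
  have hχ0 : ∀ x, 1 < ‖w x‖ → χ x = 0 := fun x hx => by
    simp [χ, LocallyConstant.coe_charFn, hx.le]
  refine ⟨χ, hχ1, hχ0, ?_⟩
  rcases isEmpty_or_nonempty X with hX | hX
  · have : h = fun _ => χ := by
      ext n x
      exact hX.elim x
    rw [this]
    exact tendsto_const_nhds
  obtain ⟨x₀, -, hx₀⟩ := isCompact_univ.exists_isMinOn univ_nonempty
    (f := fun x => |‖w x‖ - 1|) (by fun_prop)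
  set ε := |‖w x₀‖ - 1|
  have hε : 0 < ε := abs_pos.2 (sub_ne_zero.2 (hw x₀))
  have hmin : ∀ x, ε ≤ |‖w x‖ - 1| := fun x => hx₀ (mem_univ x)
  -- One constant serves both sides: `1 - ε ≤ δ` where `|w| < 1`, and `1 + ε = δ⁻¹` where `|w| > 1`.
  set δ : ℝ := (1 + ε)⁻¹
  have hδ0 : 0 < δ := by positivity
  have hδ1 : δ < 1 := inv_lt_one_of_one_lt₀ (by linarith)
  have hδε : δ * (1 + ε) = 1 := inv_mul_cancel₀ (by positivity)
  have hbound : ∀ n, dist (h n) χ ≤ δ ^ (n + 1) / (1 - δ ^ (n + 1)) := by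
    intro n
    have ht1 : δ ^ (n + 1) < 1 := pow_lt_one₀ hδ0.le hδ1 (by omega)
    have ht0 : 0 < δ ^ (n + 1) := by positivity
    refine (ContinuousMap.dist_le (div_nonneg ht0.le (by linarith))).2 fun x => ?_
    rw [dist_eq_norm, hh]
    rcases lt_or_gt_of_ne (hw x) with hx | hx
    · rw [hχ1 x hx]
      refine Complex.norm_inv_one_add_sub_one_le ht1 ?_
      rw [norm_pow]
      have := hmin x
      rw [abs_of_neg (by linarith)] at this
      gcongr
      nlinarith
    · rw [hχ0 x hx, sub_zero]
      refine Complex.norm_inv_one_add_le ht0 ht1 ?_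
      rw [norm_pow, ← mul_pow]
      have := hmin x
      rw [abs_of_pos (by linarith)] at this
      exact one_le_pow₀ (by nlinarith)
  have hpow : Tendsto (fun n : ℕ => δ ^ (n + 1)) atTop (𝓝 0) :=
    (tendsto_pow_atTop_nhds_zero_of_lt_one hδ0.le hδ1).comp (tendsto_add_atTop_nat 1)
  rw [tendsto_iff_dist_tendsto_zero]
  refine squeeze_zero (fun _ => dist_nonneg) hbound ?_
  have hlim := hpow.div (tendsto_const_nhds.sub hpow) (by norm_num : (1 : ℝ) - 0 ≠ 0)
  rwa [zero_div] at hlim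

/-- A closed, inverse-closed subalgebra of `C(X)` that separates the points of a compact scattered
space `X` is all of `C(X)`. This is a form of a theorem of Rudin, and with it the interpolation
hypothesis `MemNPInfty` is not needed for the identification of `A` with `C(Δ(A))`. -/
theorem IsScattered.subalgebra_eq_top {X : Type*} [TopologicalSpace X] [CompactSpace X]
    (hX : IsScattered X) (B : Subalgebra ℂ C(X, ℂ)) (hB : IsClosed (B : Set C(X, ℂ)))
    (hsep : B.SeparatesPoints)
    (hinv : ∀ f ∈ B, (∀ x, f x ≠ 0) → ∃ g ∈ B, f * g = 1) : B = ⊤ := by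
  let S : StarSubalgebra ℂ C(X, ℂ) :=
    { B ⊓ star B with
      star_mem' := fun {f} hf => ⟨hf.2, by simpa using hf.1⟩ }
  have hmem : ∀ f, f ∈ S ↔ f ∈ B ∧ star f ∈ B := fun f => Iff.rfl
  have hSsep : S.SeparatesPoints := by
    intro x y hxy
    obtain ⟨_, ⟨f, hf, rfl⟩, hfxy⟩ := hsep hxy
    have hd : 0 < ‖f y - f x‖ := norm_pos_iff.2 (sub_ne_zero.2 (Ne.symm hfxy))
    obtain ⟨r, ⟨hr0, hrd⟩, hr⟩ := hX.exists_mem_Ioo_notMem_range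
      (g := fun z => ‖f z - f x‖) (by fun_prop) hd
    set w : C(X, ℂ) := (r : ℂ)⁻¹ • (f - algebraMap ℂ C(X, ℂ) (f x))
    have hwB : w ∈ B := B.smul_mem (B.sub_mem hf (B.algebraMap_mem _)) _
    have hwz : ∀ z, ‖w z‖ = ‖f z - f x‖ / r := fun z => by
      simp [w, abs_of_pos hr0, div_eq_inv_mul]
    have hw1 : ∀ z, ‖w z‖ ≠ 1 := fun z hz => hr ⟨z, by
      rw [hwz, div_eq_one_iff_eq hr0.ne'] at hz
      exact hz⟩
    -- A zero would force `|w z| = 1`; this needs a positive exponent, hence `n + 1`.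
    have hne : ∀ (n : ℕ) z, (1 + w ^ (n + 1)) z ≠ 0 := fun n z hz => by
      refine hw1 z ?_
      have h1 : w z ^ (n + 1) = -1 := by
        exact eq_neg_of_add_eq_zero_right hz
      have h2 : ‖w z‖ ^ (n + 1) = 1 := by rw [← norm_pow, h1]; simp
      exact (pow_eq_one_iff_of_nonneg (norm_nonneg _) (by omega)).1 h2
    choose h hhB hh using fun n : ℕ =>
      hinv (1 + w ^ (n + 1)) (B.add_mem B.one_mem (B.pow_mem hwB _)) (hne n)
    obtain ⟨χ, hχ1, hχ0, hlim⟩ := w.exists_tendsto_inv_one_add_pow hw1 h fun n z =>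
      eq_inv_of_mul_eq_one_right (DFunLike.congr_fun (hh n) z)
    have hχB : χ ∈ B := hB.mem_of_tendsto hlim (Eventually.of_forall hhB)
    have hχstar : star χ = χ := by
      ext z
      rcases lt_or_gt_of_ne (hw1 z) with hz | hz
      · simp [hχ1 z hz]
      · simp [hχ0 z hz]
    refine ⟨χ, ⟨χ, (hmem χ).2 ⟨hχB, by rwa [hχstar]⟩, rfl⟩, ?_⟩
    rw [hχ1 x (by rw [hwz]; simp), hχ0 y (by rw [hwz, one_lt_div hr0]; exact hrd)]
    exact one_ne_zero
  have htop := ContinuousMap.starSubalgebra_topologicalClosure_eq_top_of_separatesPoints S hSsep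
  rw [eq_top_iff]
  intro f _
  have hf : f ∈ S.topologicalClosure := by rw [htop]; trivial
  exact closure_minimal (fun g hg => ((hmem g).1 hg).1) hB hf

/-- The Gelfand transform of a uniform algebra is isometric. -/
theorem IsUniformAlgebra.isometry_gelfandTransform {A : Type*} [NormedCommRing A]
    [NormedAlgebra ℂ A] [CompleteSpace A] (hA : IsUniformAlgebra A) :
    Isometry (gelfandTransform ℂ A) := by
  obtain ⟨K, _, _, _, B, e, -, he⟩ := hA
  have hnorm : ∀ a, ‖e a‖ = ‖a‖ := fun a => by
    have := he.dist_eq a 0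
    rwa [map_zero, dist_zero_right, dist_zero_right] at this
  -- `NormedCommRing` does not normalize the unit; the bound comes from `C(K)`.
  have hone : ‖(1 : A)‖ ≤ 1 := by
    rw [← hnorm, map_one]
    exact (ContinuousMap.norm_le _ zero_le_one).2 fun x => by simp
  refine AddMonoidHomClass.isometry_of_norm _ fun a => le_antisymm ?_ ?_
  · refine (ContinuousMap.norm_le _ (norm_nonneg a)).2 fun φ => ?_
    calc ‖φ a‖ ≤ ‖a‖ * ‖(1 : A)‖ :=
          spectrum.norm_le_norm_mul_of_mem (AlgHom.apply_mem_spectrum φ a)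
      _ ≤ ‖a‖ := mul_le_of_le_one_right (norm_nonneg a) hone
  · rw [← hnorm]
    refine (ContinuousMap.norm_le _ (norm_nonneg _)).2 fun x => ?_
    -- Points of `K` give characters, so the supremum over characters dominates that over `K`.
    let φ : characterSpace ℂ A := CharacterSpace.equivAlgHom.symm
      (((ContinuousMap.evalAlgHom ℂ ℂ x).comp B.val).comp (e : A →ₐ[ℂ] B))
    exact (gelfandTransform ℂ A a).norm_coe_le_norm φ

/-- The equality `A = C(Δ(A))` means that the Gelfand transform is an isometric isomorphism of `A`
onto `C(Δ(A))`. -/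
theorem theorem3 {A : Type*} [NormedCommRing A] [NormedAlgebra ℂ A] [CompleteSpace A]
    (hA : IsUniformAlgebra A) (hscat : IsScattered (WeakDual.characterSpace ℂ A))
    (hNP : MemNPInfty A) :
    Isometry (WeakDual.gelfandTransform ℂ A) ∧
      Function.Bijective (WeakDual.gelfandTransform ℂ A) := by
  have hiso := hA.isometry_gelfandTransform
  refine ⟨hiso, hiso.injective, ?_⟩
  rw [← AlgHom.range_eq_top]
  refine hscat.subalgebra_eq_top _ ?_ ?_ ?_
  · rw [AlgHom.coe_range]
    exact hiso.isClosedEmbedding.isClosed_range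
  · intro φ ψ hφψ
    obtain ⟨a, ha⟩ : ∃ a, φ a ≠ ψ a := by
      by_contra! h
      exact hφψ (WeakDual.CharacterSpace.ext h)
    exact ⟨_, ⟨_, ⟨a, rfl⟩, rfl⟩, ha⟩
  · rintro _ ⟨a, rfl⟩ ha
    have hunit : IsUnit a := by
      by_contra hu
      obtain ⟨φ, hφ⟩ := WeakDual.CharacterSpace.exists_apply_eq_zero hu
      exact ha φ hφ
    obtain ⟨b, hb⟩ := hunit.exists_right_inv
    exact ⟨_, ⟨b, rfl⟩, by
      change gelfandTransform ℂ A a * gelfandTransform ℂ A b = 1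
      rw [← map_mul, hb, map_one]⟩
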